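/- For $u\in L^2(\mathbb{R})$ let $\hat u$ denote its Fourier transform, normalized by $\hat u(\xi)=\int_{\mathbb{R}}u(t)e^{-2i\pi\xi t}\,dt$ on $L^1(\mathbb{R})\cap L^2(\mathbb{R})$ and extended to $L^2(\mathbb{R})$ by continuity, and let $$A(u)(x,y)=\int_{\mathbb{R}}u\left(t+\tfrac{x}{2}\right)\overline{u\left(t-\tfrac{x}{2}\right)}\,e^{-2i\pi ty}\,dt\qquad(x,y\in\mathbb{R})$$ be its ambiguity function. Theorem. Let $u\in L^2(\mathbb{R})$, $u\neq 0$, be such that $t\,u(t)\in L^2(\mathbb{R})$ and $\xi\,\hat u(\xi)\in L^2(\mathbb{R})$. Then $\inf_{a\in\mathbb{R}}\bigl\||t-a|\,u(t)\bigr\|_2>0$ and $\inf_{\omega\in\mathbb{R}}\bigl\||\xi-\omega|\,\hat u(\xi)\bigr\|_2>0$, and $A(u)$ has no zero in the convex hull (a closed rhombus) of the four points $$\left(\pm\frac{\sqrt2\,\|u\|_2}{2\pi\inf_{\omega\in\mathbb{R}}\bigl\||\xi-\omega|\,\hat u(\xi)\bigr\|_2},\,0\right)\quad\text{and}\quad\left(0,\,\pm\frac{\sqrt2\,\|u\|_2}{2\pi\inf_{a\in\mathbb{R}}\bigl\||t-a|\,u(t)\bigr\|_2}\right).$$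 -/

import Mathlib

open MeasureTheory
open scoped FourierTransform ENNReal

noncomputable section

/-- The radar ambiguity function
`A(u)(x, y) = ∫ u(t + x/2) * conj (u(t - x/2)) * exp(-2πi t y) dt`.
For square-integrable `u` the integrand is integrable, and the value depends only on
the almost-everywhere class of `u`. -/
def ambiguity (u : ℝ → ℂ) (x y : ℝ) : ℂ :=
  ∫ t : ℝ, u (t + x / 2) * (starRingEnd ℂ) (u (t - x / 2)) *
    Complex.exp (-2 * Real.pi * Complex.I * t * y)

/-- The minimal second-moment norm `inf_a ‖ |t - a| f(t) ‖_{L²}`. -/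
def dispersion (f : ℝ → ℂ) : ℝ :=
  ⨅ a : ℝ, (eLpNorm (fun t : ℝ => ((|t - a| : ℝ) : ℂ) * f t) 2 volume).toReal

end

open scoped InnerProductSpace

/-! A zero of `A(u)` at `(x, y)` makes the modulation of `u` by `y` orthogonal to its translate by
`x`; both have norm `‖u‖`, so they lie `√2 ‖u‖` apart, whatever unimodular factors they carry. Pass
through `u` by the triangle inequality: `|exp (iθ) - 1| ≤ |θ|` bounds the modulation leg by `2π|y|`
times the dispersion of `u`, and Plancherel turns the translation leg into the same estimate for `𝓕
u` (`norm_translation_sub`). The free phases allow optimal centres, and strictness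
(`norm_modulation_sub_lt`) excludes the boundary too. -/

/-- If `|f| ≤ |g|` almost everywhere without almost everywhere equality, then the inequality
between the `L²` norms is strict. -/
theorem L2_norm_lt_norm {α : Type*} {m : MeasurableSpace α} {μ : Measure α} {f g : Lp ℂ 2 μ}
    (hle : ∀ᵐ t ∂μ, ‖f t‖ ≤ ‖g t‖) (hne : ¬ ∀ᵐ t ∂μ, ‖g t‖ ≤ ‖f t‖) : ‖f‖ < ‖g‖ := by
  have hsq : ∀ h : Lp ℂ 2 μ, ‖h‖ ^ 2 = ∫ t, ‖h t‖ ^ 2 ∂μ := fun h => by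
    have h1 := @inner_self_eq_norm_sq_to_K ℂ _ _ _ _ h
    rw [L2.inner_def] at h1
    simp_rw [inner_self_eq_norm_sq_to_K] at h1
    have h2 : ((∫ t, ‖h t‖ ^ 2 ∂μ : ℝ) : ℂ) = ((‖h‖ ^ 2 : ℝ) : ℂ) := by
      rw [← integral_complex_ofReal]; simpa using h1
    exact_mod_cast h2.symm
  have hint : ∀ h : Lp ℂ 2 μ, Integrable (fun t => ‖h t‖ ^ 2) μ := fun h =>
    (memLp_two_iff_integrable_sq_norm (Lp.aestronglyMeasurable h)).1 (Lp.memLp h)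
  refine lt_of_pow_lt_pow_left₀ 2 (norm_nonneg g) ?_
  rw [hsq, hsq, ← sub_pos, ← integral_sub (hint g) (hint f)]
  have hnn : 0 ≤ᵐ[μ] fun t => ‖g t‖ ^ 2 - ‖f t‖ ^ 2 := by
    filter_upwards [hle] with t h
    exact sub_nonneg.2 (pow_le_pow_left₀ (norm_nonneg _) h 2)
  refine lt_of_le_of_ne (integral_nonneg_of_ae hnn) fun h0 => hne ?_
  filter_upwards [(integral_eq_zero_iff_of_nonneg_ae hnn ((hint g).sub (hint f))).1 h0.symm]
    with t h
  exact (sq_le_sq₀ (norm_nonneg _) (norm_nonneg _)).1 (sub_eq_zero.1 h).le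

/-- The distance from `v` to the real line spanned by `w ≠ 0` is attained. -/
theorem exists_norm_sub_real_smul_le {E : Type*} [NormedAddCommGroup E] [InnerProductSpace ℂ E]
    (v : E) {w : E} (hw : w ≠ 0) : ∃ a : ℝ, ∀ b : ℝ, ‖v - (a : ℂ) • w‖ ≤ ‖v - (b : ℂ) • w‖ := by
  have hexp : ∀ b : ℝ, ‖v - (b : ℂ) • w‖ ^ 2 =
      ‖v‖ ^ 2 - 2 * (b * RCLike.re ⟪v, w⟫_ℂ) + b ^ 2 * ‖w‖ ^ 2 := fun b => by
    rw [@norm_sub_sq ℂ, inner_smul_right, norm_smul, mul_pow]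
    simp
  have hw' : 0 < ‖w‖ := norm_pos_iff.2 hw
  -- The vertex of the quadratic in `hexp`.
  refine ⟨RCLike.re ⟪v, w⟫_ℂ / ‖w‖ ^ 2, fun b => (sq_le_sq₀ (norm_nonneg _) (norm_nonneg _)).1 ?_⟩
  rw [hexp, hexp]
  set r : ℝ := RCLike.re ⟪v, w⟫_ℂ
  have hr : r = r / ‖w‖ ^ 2 * ‖w‖ ^ 2 := by field_simp
  generalize r / ‖w‖ ^ 2 = a at hr ⊢
  rw [hr]
  nlinarith [mul_nonneg (sq_nonneg (a - b)) (sq_nonneg ‖w‖)]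

/-! ### Modulations, translations and the Fourier transform -/

/-- The unimodular function `t ↦ exp (2πi y (t - a))`. -/
noncomputable def character (y a t : ℝ) : ℂ := Complex.exp (Complex.I * ((2 * Real.pi * y * (t - a) : ℝ) : ℂ))

theorem norm_character (y a t : ℝ) : ‖character y a t‖ = 1 := by
  rw [character, mul_comm, Complex.norm_exp_ofReal_mul_I]

theorem continuous_character (y a : ℝ) : Continuous (character y a) := by
  unfold character; fun_prop

theorem norm_character_sub_one_le (y a t : ℝ) :
    ‖character y a t - 1‖ ≤ ‖2 * Real.pi * y * (t - a)‖ :=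
  Real.norm_exp_I_mul_ofReal_sub_one_le

theorem norm_character_sub_one_lt {y a t : ℝ} (hy : y ≠ 0) (ht : t ≠ a) :
    ‖character y a t - 1‖ < ‖2 * Real.pi * y * (t - a)‖ := by
  have h : 2 * Real.pi * y * (t - a) ≠ 0 := by
    have := sub_ne_zero.2 ht
    have := Real.pi_ne_zero
    positivity
  rw [character, Complex.norm_exp_I_mul_ofReal_sub_one]
  generalize 2 * Real.pi * y * (t - a) = θ at h ⊢
  have := Real.abs_sin_lt_abs (x := θ / 2) (by positivity)
  rw [abs_div, abs_two] at this
  rw [norm_mul, Real.norm_eq_abs, Real.norm_eq_abs, Real.norm_eq_abs, abs_two]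
  linarith

theorem MemLp.character_mul {f : ℝ → ℂ} (hf : MemLp f 2 volume) (y a : ℝ) :
    MemLp (fun t => character y a t * f t) 2 volume :=
  hf.of_le ((continuous_character y a).aestronglyMeasurable.mul hf.1)
    (.of_forall fun t => by rw [norm_mul, norm_character, one_mul])

/-- Multiplication by the unimodular function `character y a` on `L²(ℝ)`. -/
noncomputable def modulation (y a : ℝ) : Lp ℂ 2 (volume : Measure ℝ) →ₗᵢ[ℂ] Lp ℂ 2 (volume : Measure ℝ) where
  toFun f := (MemLp.character_mul (Lp.memLp f) y a).toLp _
  map_add' f g := by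
    rw [← MemLp.toLp_add, MemLp.toLp_eq_toLp_iff]
    filter_upwards [Lp.coeFn_add f g] with t h
    simp only [h, Pi.add_apply, mul_add]
  map_smul' c f := by
    rw [RingHom.id_apply, ← MemLp.toLp_const_smul, MemLp.toLp_eq_toLp_iff]
    filter_upwards [Lp.coeFn_smul c f] with t h
    simp only [h, Pi.smul_apply, smul_eq_mul]
    ring
  norm_map' f := by
    refine (Lp.norm_toLp _ (MemLp.character_mul (Lp.memLp f) y a)).trans ?_
    rw [Lp.norm_def]
    congr 1
    exact eLpNorm_congr_norm_ae
      (.of_forall fun t => by rw [norm_mul, norm_character, one_mul])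

theorem coeFn_modulation (y a : ℝ) (f : Lp ℂ 2 (volume : Measure ℝ)) :
    modulation y a f =ᵐ[volume] fun t => character y a t * f t :=
  MemLp.coeFn_toLp (MemLp.character_mul (Lp.memLp f) y a)

/-- Translation `f ↦ f (· + x)` on `L²(ℝ)`. -/
noncomputable def translation (x : ℝ) : Lp ℂ 2 (volume : Measure ℝ) →ₗᵢ[ℂ] Lp ℂ 2 (volume : Measure ℝ) :=
  Lp.compMeasurePreservingₗᵢ ℂ (· + x) (measurePreserving_add_right volume x)

theorem coeFn_translation (x : ℝ) (f : Lp ℂ 2 (volume : Measure ℝ)) :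
    translation x f =ᵐ[volume] fun t => f (t + x) :=
  Lp.coeFn_compMeasurePreserving f _

open SchwartzMap in
/-- The `L²` Fourier transform turns translations into modulations. -/
theorem fourier_translation (x : ℝ) (f : Lp ℂ 2 (volume : Measure ℝ)) :
    𝓕 (translation x f) = modulation x 0 (𝓕 f) := by
  refine DenseRange.induction_on (p := fun f => 𝓕 (translation x f) = modulation x 0 (𝓕 f))
    (SchwartzMap.denseRange_toLpCLM (p := 2) ENNReal.ofNat_ne_top) f
    (isClosed_eq ?_ ?_) fun g => ?_
  · exact (Lp.fourierTransformₗᵢ ℝ ℂ).continuous.comp (translation x).continuous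
  · exact (modulation x 0).continuous.comp (Lp.fourierTransformₗᵢ ℝ ℂ).continuous
  · have h1 : translation x (g.toLp 2) = (g.compSubConstCLM ℂ (-x)).toLp 2 := by
      refine Lp.ext ?_
      filter_upwards [coeFn_translation x (g.toLp 2),
        (g.compSubConstCLM ℂ (-x)).coeFn_toLp 2,
        (measurePreserving_add_right volume x).quasiMeasurePreserving.ae (g.coeFn_toLp 2 volume)]
        with t h1 h2 h3
      rw [h1, h2, h3, SchwartzMap.compSubConstCLM_apply, sub_neg_eq_add]
    rw [SchwartzMap.toLpCLM_apply, h1, SchwartzMap.toLp_fourier_eq, SchwartzMap.toLp_fourier_eq]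
    refine Lp.ext ?_
    filter_upwards [(𝓕 (g.compSubConstCLM ℂ (-x))).coeFn_toLp 2,
      coeFn_modulation x 0 ((𝓕 g).toLp 2), (𝓕 g).coeFn_toLp 2] with ξ h1 h2 h3
    rw [h1, h2, h3, SchwartzMap.fourier_coe, SchwartzMap.fourier_coe]
    have h4 : (g.compSubConstCLM ℂ (-x) : ℝ → ℂ) = g ∘ fun t => t + x := by
      ext t; simp
    rw [h4]
    refine (congrFun (VectorFourier.fourierIntegral_comp_add_right Real.fourierChar volume
      (innerₗ ℝ) g x) ξ).trans ?_
    rw [Circle.smul_def, Real.fourierChar_apply, smul_eq_mul, character]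
    congr 1
    congr 1
    simp only [innerₗ_apply_apply, RCLike.inner_apply, conj_trivial, sub_zero]
    push_cast
    ring

theorem modulation_eq_smul (x ω : ℝ) (f : Lp ℂ 2 (volume : Measure ℝ)) :
    modulation x ω f = character x ω 0 • modulation x 0 f := by
  refine Lp.ext ?_
  filter_upwards [coeFn_modulation x ω f, coeFn_modulation x 0 f,
    Lp.coeFn_smul (character x ω 0) (modulation x 0 f)] with t h1 h2 h3
  rw [h1, h3, Pi.smul_apply, h2, smul_eq_mul, ← mul_assoc, character, character, character,
    ← Complex.exp_add]
  congr 2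
  push_cast
  ring

/-- Plancherel; the constant phase on the left recentres the modulation at `ω`. -/
theorem norm_translation_sub (x ω : ℝ) (f : Lp ℂ 2 (volume : Measure ℝ)) :
    ‖character x ω 0 • translation x f - f‖ = ‖modulation x ω (𝓕 f) - 𝓕 f‖ := by
  rw [← Lp.norm_fourier_eq, sub_eq_add_neg, FourierTransform.fourier_add,
    FourierTransform.fourier_smul, FourierTransform.fourier_neg, fourier_translation,
    modulation_eq_smul x ω, ← sub_eq_add_neg]

/-! ### Modulation estimates by second moments -/

section Dispersion

variable {f : Lp ℂ 2 (volume : Measure ℝ)}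
  (hf : MemLp (fun t : ℝ => (t : ℂ) * f t) 2 volume)

include hf

theorem coeFn_toLp_sub_smul (a : ℝ) :
    (hf.toLp _ - (a : ℂ) • f : Lp ℂ 2 (volume : Measure ℝ)) =ᵐ[volume]
      fun t => ((t - a : ℝ) : ℂ) * f t := by
  filter_upwards [Lp.coeFn_sub (hf.toLp _) ((a : ℂ) • f), Lp.coeFn_smul (a : ℂ) f,
    hf.coeFn_toLp] with t h1 h2 h3
  rw [h1, Pi.sub_apply, h2, h3, Pi.smul_apply, smul_eq_mul]
  push_cast
  ring

theorem toReal_eLpNorm_eq_norm (a : ℝ) :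
    (eLpNorm (fun t : ℝ => ((|t - a| : ℝ) : ℂ) * f t) 2 volume).toReal =
      ‖hf.toLp _ - (a : ℂ) • f‖ := by
  rw [Lp.norm_def]
  congr 1
  refine eLpNorm_congr_norm_ae ?_
  filter_upwards [coeFn_toLp_sub_smul hf a] with t h
  rw [h, norm_mul, norm_mul, Complex.norm_real, Complex.norm_real, Real.norm_eq_abs, abs_abs,
    Real.norm_eq_abs]

theorem exists_dispersion_eq (h0 : f ≠ 0) :
    ∃ a : ℝ, dispersion f = ‖hf.toLp _ - (a : ℂ) • f‖ := by
  obtain ⟨a, ha⟩ := exists_norm_sub_real_smul_le (hf.toLp _) h0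
  refine ⟨a, ?_⟩
  unfold dispersion
  simp_rw [toReal_eLpNorm_eq_norm hf]
  exact le_antisymm (ciInf_le ⟨0, by rintro _ ⟨b, rfl⟩; exact norm_nonneg _⟩ a) (le_ciInf ha)

/-- The pointwise bound is strict off the null set `{a}` wherever `f` is nonzero, so equality would
force `f = 0`. -/
theorem norm_modulation_sub_lt (h0 : f ≠ 0) {y : ℝ} (hy : y ≠ 0) (a : ℝ) :
    ‖modulation y a f - f‖ < 2 * Real.pi * |y| * ‖hf.toLp _ - (a : ℂ) • f‖ := by
  have hc : ‖((2 * Real.pi * y : ℝ) : ℂ)‖ = 2 * Real.pi * |y| := by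
    rw [Complex.norm_real, norm_mul, Real.norm_of_nonneg Real.two_pi_pos.le, Real.norm_eq_abs]
  rw [← hc, ← norm_smul]
  have hl : (modulation y a f - f : Lp ℂ 2 (volume : Measure ℝ)) =ᵐ[volume]
      fun t => (character y a t - 1) * f t := by
    filter_upwards [Lp.coeFn_sub (modulation y a f) f, coeFn_modulation y a f] with t h1 h2
    rw [h1, Pi.sub_apply, h2, sub_mul, one_mul]
  have hr : (((2 * Real.pi * y : ℝ) : ℂ) • (hf.toLp _ - (a : ℂ) • f) :
      Lp ℂ 2 (volume : Measure ℝ)) =ᵐ[volume]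
      fun t => ((2 * Real.pi * y * (t - a) : ℝ) : ℂ) * f t := by
    filter_upwards [Lp.coeFn_smul ((2 * Real.pi * y : ℝ) : ℂ) (hf.toLp _ - (a : ℂ) • f),
      coeFn_toLp_sub_smul hf a] with t h1 h2
    rw [h1, Pi.smul_apply, h2, smul_eq_mul]
    push_cast
    ring
  refine L2_norm_lt_norm ?_ fun hle => h0 ?_
  · filter_upwards [hl, hr] with t h1 h2
    rw [h1, h2, norm_mul, norm_mul, Complex.norm_real]
    exact mul_le_mul_of_nonneg_right (norm_character_sub_one_le y a t) (norm_nonneg _)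
  · rw [Lp.eq_zero_iff_ae_eq_zero]
    filter_upwards [hl, hr, hle, compl_mem_ae_iff.2 (measure_singleton a)] with t h1 h2 h3 h4
    rw [h1, h2, norm_mul, norm_mul, Complex.norm_real] at h3
    by_contra hft
    exact absurd h3 (not_le.2 (mul_lt_mul_of_pos_right (norm_character_sub_one_lt hy h4)
      (norm_pos_iff.2 hft)))

/-- One minimizing centre serves every `y`. -/
theorem exists_norm_modulation_sub (h0 : f ≠ 0) :
    ∃ a : ℝ, ∀ y : ℝ, ‖modulation y a f - f‖ ≤ 2 * Real.pi * |y| * dispersion f ∧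
      (y ≠ 0 → ‖modulation y a f - f‖ < 2 * Real.pi * |y| * dispersion f) := by
  obtain ⟨a, ha⟩ := exists_dispersion_eq hf h0
  refine ⟨a, fun y => ?_⟩
  rw [ha]
  refine ⟨?_, fun hy => norm_modulation_sub_lt hf h0 hy a⟩
  rcases eq_or_ne y 0 with rfl | hy
  · have h1 : modulation 0 a f = f := by
      refine Lp.ext ?_
      filter_upwards [coeFn_modulation 0 a f] with t h
      simp [h, character]
    simp [h1]
  · exact (norm_modulation_sub_lt hf h0 hy a).le

theorem dispersion_pos (h0 : f ≠ 0) : 0 < dispersion f := by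
  obtain ⟨a, ha⟩ := exists_norm_modulation_sub hf h0
  have h := (norm_nonneg _).trans_lt ((ha 1).2 one_ne_zero)
  rw [abs_one, mul_one] at h
  exact pos_of_mul_pos_right h Real.two_pi_pos.le

end Dispersion

/-! ### Zeros of the ambiguity function -/

/-- Up to a unimodular constant, the ambiguity function is the inner product of a modulation
and a translation of the signal. -/
theorem ambiguity_eq_inner (u : Lp ℂ 2 (volume : Measure ℝ)) (x y a : ℝ) :
    ambiguity u x y = character (-y) (-(x / 2) - a) 0 *
      ⟪modulation y a u, translation x u⟫_ℂ := by
  unfold ambiguity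
  rw [← integral_add_right_eq_self _ (x / 2), L2.inner_def, ← integral_const_mul]
  refine integral_congr_ae ?_
  filter_upwards [coeFn_modulation y a u, coeFn_translation x u] with t h1 h2
  rw [h1, h2, RCLike.inner_apply, map_mul, add_assoc, add_halves, add_sub_cancel_right]
  have h3 : (starRingEnd ℂ) (character y a t) = character (-y) a t := by
    rw [character, character, ← Complex.exp_conj, map_mul, Complex.conj_I, Complex.conj_ofReal]
    congr 1
    push_cast
    ring
  have h4 : Complex.exp (-2 * Real.pi * Complex.I * (t + x / 2 : ℝ) * y) =
      character (-y) (-(x / 2) - a) 0 * character (-y) a t := by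
    rw [character, character, ← Complex.exp_add]
    congr 1
    push_cast
    ring
  rw [h3, h4]
  ring

/-- Pythagoras for two orthogonal vectors of norm `‖u‖`. -/
theorem norm_sub_of_ambiguity_eq_zero {u : Lp ℂ 2 (volume : Measure ℝ)} {x y : ℝ}
    (h : ambiguity u x y = 0) (a : ℝ) {c : ℂ} (hc : ‖c‖ = 1) :
    ‖modulation y a u - c • translation x u‖ = Real.sqrt 2 * ‖u‖ := by
  rw [ambiguity_eq_inner u x y a] at h
  have h1 : ⟪modulation y a u, translation x u⟫_ℂ = 0 :=
    (mul_eq_zero.1 h).resolve_left (norm_ne_zero_iff.1 (by rw [norm_character]; exact one_ne_zero))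
  rw [← sq_eq_sq₀ (norm_nonneg _) (by positivity), @norm_sub_sq ℂ, inner_smul_right, h1,
    norm_smul, hc, LinearIsometry.norm_map, LinearIsometry.norm_map, mul_pow, mul_pow,
    Real.sq_sqrt zero_le_two, mul_zero, map_zero]
  ring

/-- The convex hull of `(±α, 0)` and `(0, ±β)` lies in the rhombus `|x| / α + |y| / β ≤ 1`. -/
theorem convexHull_rhombus_subset {α β : ℝ} (hα : 0 < α) (hβ : 0 < β) :
    convexHull ℝ ({(α, 0), (-α, 0), (0, β), (0, -β)} : Set (ℝ × ℝ)) ⊆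
      {p | |p.1| / α + |p.2| / β ≤ 1} := by
  refine convexHull_min ?_ ?_
  · rintro p (rfl | rfl | rfl | rfl) <;>
      simp [abs_of_pos hα, abs_of_pos hβ, hα.ne', hβ.ne']
  · intro p hp q hq s t hs ht hst
    simp only [Set.mem_ofPred_eq, Prod.fst_add, Prod.snd_add, Prod.smul_fst, Prod.smul_snd,
      smul_eq_mul] at hp hq ⊢
    have key : ∀ b c : ℝ, |s * b + t * c| ≤ s * |b| + t * |c| := fun b c => by
      simpa [abs_mul, abs_of_nonneg hs, abs_of_nonneg ht] using abs_add_le (s * b) (t * c)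
    calc |s * p.1 + t * q.1| / α + |s * p.2 + t * q.2| / β
        ≤ (s * |p.1| + t * |q.1|) / α + (s * |p.2| + t * |q.2|) / β := by
          gcongr <;> exact key _ _
      _ = s * (|p.1| / α + |p.2| / β) + t * (|q.1| / α + |q.2| / β) := by ring
      _ ≤ s * 1 + t * 1 := by gcongr
      _ = 1 := by rw [mul_one, mul_one, hst]

/-- Zero-free rhombus of the ambiguity function of a nonzero signal `u ∈ L²(ℝ)` with
`t u ∈ L²` and `ξ û ∈ L²`, where `û = 𝓕 u` is the (unitary) Fourier transform on `L²(ℝ)`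
with kernel `exp(-2πi ξ t)`. -/
theorem theorem2 (u : Lp ℂ 2 (volume : Measure ℝ)) (hu : u ≠ 0)
    (ht : MemLp (fun t : ℝ => (t : ℂ) * u t) 2 volume)
    (hξ : MemLp (fun ξ : ℝ => (ξ : ℂ) * (𝓕 u : Lp ℂ 2 (volume : Measure ℝ)) ξ) 2 volume) :
    0 < dispersion u ∧
    0 < dispersion (𝓕 u : Lp ℂ 2 (volume : Measure ℝ)) ∧
    ∀ p ∈ convexHull ℝ
      ({(Real.sqrt 2 * ‖u‖ /
            (2 * Real.pi * dispersion (𝓕 u : Lp ℂ 2 (volume : Measure ℝ))), 0),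
        (-(Real.sqrt 2 * ‖u‖ /
            (2 * Real.pi * dispersion (𝓕 u : Lp ℂ 2 (volume : Measure ℝ)))), 0),
        (0, Real.sqrt 2 * ‖u‖ / (2 * Real.pi * dispersion u)),
        (0, -(Real.sqrt 2 * ‖u‖ / (2 * Real.pi * dispersion u)))} : Set (ℝ × ℝ)),
      ambiguity u p.1 p.2 ≠ 0 := by 
  have hv : (𝓕 u : Lp ℂ 2 (volume : Measure ℝ)) ≠ 0 := by
    rwa [← norm_ne_zero_iff, Lp.norm_fourier_eq, norm_ne_zero_iff]
  have hσ := dispersion_pos ht hu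
  have hτ := dispersion_pos hξ hv
  refine ⟨hσ, hτ, fun p hp hA => ?_⟩
  obtain ⟨x, y⟩ := p
  have hu' : 0 < ‖u‖ := norm_pos_iff.2 hu
  have h2 : 0 < Real.sqrt 2 * ‖u‖ := by positivity
  have hxy := convexHull_rhombus_subset (by positivity) (by positivity) hp
  simp only [Set.mem_ofPred_eq] at hxy hA
  rw [div_div_eq_mul_div, div_div_eq_mul_div, ← add_div, div_le_one h2] at hxy
  obtain ⟨a, ha⟩ := exists_norm_modulation_sub ht hu
  obtain ⟨ω, hω⟩ := exists_norm_modulation_sub hξ hv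
  have hN := norm_sub_of_ambiguity_eq_zero hA a (norm_character x ω 0)
  have htri := norm_sub_le_norm_sub_add_norm_sub (modulation y a u) u
    (character x ω 0 • translation x u)
  rw [hN, norm_sub_rev u, norm_translation_sub] at htri
  have hx := hω x
  have hy := ha y
  -- Off the origin one leg is strict; at the origin both vanish, against `√2 ‖u‖ > 0`.
  rcases eq_or_ne x 0 with rfl | hx0
  · rcases eq_or_ne y 0 with rfl | hy0
    · have h1 := hx.1
      have h3 := hy.1
      simp only [abs_zero, mul_zero, zero_mul] at h1 h3
      linarith
    · linarith [hx.1, hy.2 hy0]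
  · linarith [hx.2 hx0, hy.1]
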